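/- Let $s>0$ and consider $u_t=u_{xx}+\dfrac{u^3}{1+su^2}$ on the real line. An unbounded traveling wave solution with speed $c>0$ is a $C^2$, positive, (strictly) monotonically decreasing profile $\phi:\mathbb{R}\to\mathbb{R}$, $u(t,x)=\phi(x-ct)$, satisfying $$-c\phi'=\phi''+\frac{\phi^3}{1+s\phi^2},\qquad \phi(-\infty)=+\infty,\qquad \phi(+\infty)=0 .$$ Consider the phase-plane vector field $\phi'=\psi+s\phi^2\psi$, $\psi'=-c\psi-cs\phi^2\psi-\phi^3$, which is the traveling wave system $\phi'=\psi$, $\psi'=-c\psi-\phi^3/(1+s\phi^2)$ multiplied by $1+s\phi^2$, and its Poincaré compactification on the closed hemisphere $\{y\in\mathbb{S}^2: y_3\ge 0\}$, where the phase plane is embedded by $(\phi,\psi)\mapsto(\phi,\psi,1)/\sqrt{\phi^2+\psi^2+1}$. The equilibria at infinity are the zeros of the compactified vector field on the equator $y_3=0$. A profile $\phi$ is said to be of type $e$, where $e$ is an equilibrium at infinity, if its orbit $(\phi,\phi')$ connects $e$ to the origin, that is, it tends to $e$ in the hemisphere as $\xi\to-\infty$ and to $(0,0)$ as $\xi\to+\infty$.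 Then there is a minimal speed $c_*>0$, given explicitly by $c_*=2/\sqrt{s}$, such that: (i) if $0<c<c_*$, there is no unbounded traveling wave solution with speed $c$; (ii) if $c=c_*$, there is exactly one type of unbounded traveling wave solution with speed $c$; (iii) if $c>c_*$, there are exactly two types of unbounded traveling wave solutions with speed $c$. Here "exactly $n$ types" means that every unbounded traveling wave solution with speed $c$ is of type $e$ for some equilibrium at infinity $e$, and that exactly $n$ equilibria at infinity occur as types of such solutions. -/

import Mathlib

open Filter Topology

noncomputable section

/-- An unbounded traveling wave solution with speed `c` of `u_t = u_xx + u^3 / (1 + s u^2)`: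
a positive, monotonically decreasing profile `φ` on `ℝ`, where `u(t, x) = φ(x - c t)`, with
`-c φ' = φ'' + φ^3 / (1 + s φ^2)`, `φ(-∞) = +∞` and `φ(+∞) = 0`. -/
structure IsUnboundedTW (s c : ℝ) (φ : ℝ → ℝ) : Prop where
  contDiff : ContDiff ℝ 2 φ
  eqn : ∀ ξ, -c * deriv φ ξ = deriv (deriv φ) ξ + φ ξ ^ 3 / (1 + s * φ ξ ^ 2)
  pos : ∀ ξ, 0 < φ ξ
  decreasing : StrictAnti φ
  lim_neg : Tendsto φ atBot atTop
  lim_pos : Tendsto φ atTop (𝓝 0)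

/-- `Δ(φ, ψ) = √(φ² + ψ² + 1)`. -/
def bigDelta (φ ψ : ℝ) : ℝ := √(φ ^ 2 + ψ ^ 2 + 1)

/-- The central projection of the phase plane onto the open upper hemisphere `y₃ > 0` of the
Poincaré sphere `y₁² + y₂² + y₃² = 1`. The equator `y₃ = 0` is the circle at infinity. -/
def toHemisphere (φ ψ : ℝ) : ℝ × ℝ × ℝ :=
  (φ / bigDelta φ ψ, ψ / bigDelta φ ψ, 1 / bigDelta φ ψ)

/-- First component of the phase-plane vector field `φ' = ψ`, `ψ' = -c ψ - φ³ / (1 + s φ²)`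
multiplied by the positive factor `1 + s φ²`. -/
def fieldP (s φ ψ : ℝ) : ℝ := ψ + s * φ ^ 2 * ψ

/-- Second component of the same polynomial (cubic) vector field. -/
def fieldQ (s c φ ψ : ℝ) : ℝ := -c * ψ - c * s * φ ^ 2 * ψ - φ ^ 3

/-- `y₃³ P(y₁ / y₃, y₂ / y₃)`, extended to `y₃ = 0`. -/
def homP (s : ℝ) (y : ℝ × ℝ × ℝ) : ℝ := y.2.1 * y.2.2 ^ 2 + s * y.1 ^ 2 * y.2.1

/-- `y₃³ Q(y₁ / y₃, y₂ / y₃)`, extended to `y₃ = 0`. -/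
def homQ (s c : ℝ) (y : ℝ × ℝ × ℝ) : ℝ :=
  -c * y.2.1 * y.2.2 ^ 2 - c * s * y.1 ^ 2 * y.2.1 - y.1 ^ 3

/-- The Poincaré compactification of the vector field `(P, Q)`: its push-forward to the sphere,
multiplied by `y₃²` (a change of time), which extends to the equator. -/
def compactField (s c : ℝ) (y : ℝ × ℝ × ℝ) : ℝ × ℝ × ℝ :=
  (homP s y - y.1 * (y.1 * homP s y + y.2.1 * homQ s c y),
   homQ s c y - y.2.1 * (y.1 * homP s y + y.2.1 * homQ s c y),
   -(y.2.2 * (y.1 * homP s y + y.2.1 * homQ s c y)))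

/-- `compactField` is, up to the factor `y₃² = Δ⁻²`, the push-forward of `(P, Q)`. -/
theorem hasDerivAt_toHemisphere (s c : ℝ) (p q : ℝ → ℝ) (t : ℝ)
    (hp : HasDerivAt p (fieldP s (p t) (q t)) t)
    (hq : HasDerivAt q (fieldQ s c (p t) (q t)) t) :
    HasDerivAt (fun r => toHemisphere (p r) (q r))
      (bigDelta (p t) (q t) ^ 2 • compactField s c (toHemisphere (p t) (q t))) t := by
  have hpos : 0 < p t ^ 2 + q t ^ 2 + 1 := by positivity
  have hD : 0 < bigDelta (p t) (q t) := Real.sqrt_pos.2 hpos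
  have hsq : bigDelta (p t) (q t) ^ 2 = p t ^ 2 + q t ^ 2 + 1 := Real.sq_sqrt hpos.le
  have hd : HasDerivAt (fun r => bigDelta (p r) (q r))
      ((p t * fieldP s (p t) (q t) + q t * fieldQ s c (p t) (q t)) / bigDelta (p t) (q t)) t := by
    have h := (((hp.pow 2).add (hq.pow 2)).add_const 1).sqrt hpos.ne'
    refine h.congr_deriv ?_
    simp only [bigDelta, Pi.add_apply, Pi.pow_apply]
    field_simp
    norm_num
    ring
  have h1 := hp.div hd hD.ne'
  have h2 := hq.div hd hD.ne'
  have h3 := (hasDerivAt_const t (1 : ℝ)).div hd hD.ne'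
  refine (h1.prodMk (h2.prodMk h3)).congr_deriv ?_
  simp only [toHemisphere, compactField, homP, homQ, fieldP, fieldQ, Prod.smul_mk, smul_eq_mul,
    Prod.mk.injEq]
  generalize bigDelta (p t) (q t) = D at *
  generalize p t = a at *
  generalize q t = b at *
  refine ⟨?_, ?_, ?_⟩
  · field_simp
  · field_simp
  · field_simp
    ring

/-- An equilibrium at infinity: a zero of the compactified vector field on the equator. -/
def IsEquilibriumAtInfinity (s c : ℝ) (e : ℝ × ℝ × ℝ) : Prop :=
  e.1 ^ 2 + e.2.1 ^ 2 + e.2.2 ^ 2 = 1 ∧ e.2.2 = 0 ∧ compactField s c e = 0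

/-- The orbit `(φ, φ')` connects the point `e` of the closed hemisphere to the origin of the
phase plane. -/
def ConnectsToOrigin (φ : ℝ → ℝ) (e : ℝ × ℝ × ℝ) : Prop :=
  Tendsto (fun ξ => toHemisphere (φ ξ) (deriv φ ξ)) atBot (𝓝 e) ∧
    Tendsto (fun ξ => toHemisphere (φ ξ) (deriv φ ξ)) atTop (𝓝 (toHemisphere 0 0))

/-- `φ` is an unbounded traveling wave solution of type `e`: its orbit connects the equilibrium
at infinity `e` to the origin. -/
def HasType (s c : ℝ) (φ : ℝ → ℝ) (e : ℝ × ℝ × ℝ) : Prop :=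
  IsUnboundedTW s c φ ∧ IsEquilibriumAtInfinity s c e ∧ ConnectsToOrigin φ e

/-- There are exactly `n` types of unbounded traveling wave solutions with speed `c`: each
solution has a type, and exactly `n` equilibria at infinity occur as types of solutions. -/
def ExactlyTypes (s c : ℝ) (n : ℕ) : Prop :=
  (∀ φ, IsUnboundedTW s c φ → ∃ e, HasType s c φ e) ∧
    {e | ∃ φ, HasType s c φ e}.encard = n

end

/-!
Let `r(w) = w² + c w + 1/s`, the characteristic polynomial of the travelling wave equation
linearised at infinity, where the nonlinearity is asymptotic to `φ / s`. Its discriminant is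
`c² - 4/s`, so it has no, one or two real roots according to `c < 2/√s`, `c = 2/√s` or `c > 2/√s`.
The types of unbounded waves turn out to correspond exactly to these roots.

*Every wave has a slope.* For a wave `φ`, the quotient `w = φ'/φ` is negative and satisfies
`w' = -(r(w) - h)`, where `h → 0` at `-∞` because `φ → +∞` there. Read backwards in time this is a
bounded solution of an asymptotically autonomous scalar equation, hence it converges to a root of `r`
(`IsUnboundedTW.exists_slope`). If `w → m` then the orbit tends to the point at infinity in the
direction `(1, m)`, which is an equilibrium. In particular there is no wave if `r` has no root.

*Every root is a slope.* Write the nonlinearity as `φ / s` minus a deficit, which is nonnegative for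
`φ > 0`, globally Lipschitz with constant `1/s` and `O(1/φ)`. For a root `m < 0`, the function
`e^{mξ}` solves the linear equation, and a correction `e^{-mξ} b` with `b` bounded is found globally
on the line by Banach's fixed point theorem: the inverse of the linear operator is a composition of
two exponential averages with nonnegative kernels, and its norm in the weight `e^{-mξ}` is less
than `s`. The solution `φ = e^{mξ} + e^{-mξ} b` is positive because the kernels are, and `φ'/φ → m`
at `-∞`. Monotonicity follows since `e^{cξ} φ'` is decreasing, and then `φ → 0` at `+∞`
(`exists_isUnboundedTW_slope`). No phase-plane analysis or flow is needed.
-/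

/-! ### Scalar asymptotics -/

/-- A function whose derivative is eventually bounded below by a positive constant tends to
infinity. -/
theorem tendsto_atTop_of_le_deriv {v v' : ℝ → ℝ} {δ T : ℝ} (hδ : 0 < δ)
    (hv : ∀ t, HasDerivAt v (v' t) t) (h : ∀ t ≥ T, δ ≤ v' t) : Tendsto v atTop atTop := by
  have key : ∀ t ≥ T, v T + δ * (t - T) ≤ v t := by
    intro t ht
    have := (convex_Ici T).mul_sub_le_image_sub_of_le_deriv (f := v) (C := δ)
      (fun x _ => (hv x).continuousAt.continuousWithinAt)
      (fun x _ => (hv x).differentiableAt.differentiableWithinAt)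
      (fun x hx => by
        rw [interior_Ici] at hx
        rw [(hv x).deriv]
        exact h x hx.le) T (Set.mem_Ici.2 le_rfl) t ht ht
    linarith
  refine tendsto_atTop_mono' atTop ((eventually_ge_atTop T).mono key) ?_
  exact tendsto_atTop_add_const_left _ _
    ((tendsto_atTop_add_const_right _ (-T) tendsto_id).const_mul_atTop hδ)

theorem tendsto_atBot_of_deriv_le {v v' : ℝ → ℝ} {δ T : ℝ} (hδ : 0 < δ)
    (hv : ∀ t, HasDerivAt v (v' t) t) (h : ∀ t ≥ T, v' t ≤ -δ) : Tendsto v atTop atBot :=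
  tendsto_neg_atTop_iff.1 <| tendsto_atTop_of_le_deriv hδ (fun t => (hv t).neg)
    fun t ht => le_neg_of_le_neg (h t ht)

/-- A level that a function can only cross upwards is never crossed back. -/
theorem le_of_deriv_pos_at_level {v v' : ℝ → ℝ} {a T : ℝ} (hv : ∀ t, HasDerivAt v (v' t) t)
    (ha : a ≤ v T) (h : ∀ t ≥ T, v t = a → 0 < v' t) : ∀ t ≥ T, a ≤ v t := by
  intro t ht
  have := image_le_of_deriv_right_lt_deriv_boundary' (f := fun t => -v t) (f' := fun t => -v' t)
    (a := T) (b := t) (fun x _ => (hv x).neg.continuousAt.continuousWithinAt)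
    (fun x _ => (hv x).neg.hasDerivWithinAt) (B := fun _ => -a) (B' := fun _ => 0)
    (by simpa using ha) continuousOn_const (fun x _ => hasDerivWithinAt_const _ _ _)
    (fun x hx hxa => by simpa using h x hx.1 (neg_inj.1 hxa)) (Set.right_mem_Icc.2 ht)
  simpa using this

theorem le_of_deriv_neg_at_level {v v' : ℝ → ℝ} {a T : ℝ} (hv : ∀ t, HasDerivAt v (v' t) t)
    (ha : v T ≤ a) (h : ∀ t ≥ T, v t = a → v' t < 0) : ∀ t ≥ T, v t ≤ a := by
  intro t ht
  have := le_of_deriv_pos_at_level (v := fun t => -v t) (fun t => (hv t).neg) (neg_le_neg ha)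
    (fun t ht hta => neg_pos.2 (h t ht (neg_inj.1 hta))) t ht
  exact neg_le_neg_iff.1 this

/-- A bounded solution of the asymptotically autonomous scalar equation `v' = p(v) - e(t)`,
`e → 0`, converges to a zero of `p`. An oscillating solution would cross some level `a` with
`p a ≠ 0` infinitely often in both directions, whereas for large times all crossings of this level
go in the direction given by the sign of `p a`. -/
theorem exists_tendsto_zero_of_asymptotically_autonomous {v p e : ℝ → ℝ} {lo hi : ℝ}
    (hv : ∀ t, HasDerivAt v (p (v t) - e t) t) (he : Tendsto e atTop (𝓝 0))
    (hp : Continuous p) (hd : Dense {a | p a ≠ 0})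
    (hlo : ∀ t ≥ 0, lo ≤ v t) (hhi : ∀ t ≥ 0, v t ≤ hi) :
    ∃ m, p m = 0 ∧ Tendsto v atTop (𝓝 m) := by
  have hbl : IsBoundedUnder (· ≥ ·) atTop v := ⟨lo, eventually_map.2 <|
    (eventually_ge_atTop 0).mono hlo⟩
  have hbu : IsBoundedUnder (· ≤ ·) atTop v := ⟨hi, eventually_map.2 <|
    (eventually_ge_atTop 0).mono hhi⟩
  obtain ⟨m, hm⟩ : ∃ m, Tendsto v atTop (𝓝 m) := by
    refine tendsto_of_no_upcrossings hd ?_ hbu hbl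
    rintro a ha b - hab ⟨h1, h2⟩
    rcases lt_or_gt_of_ne (show p a ≠ 0 from ha) with hpa | hpa
    · obtain ⟨T, hT⟩ := eventually_atTop.1 (he.eventually (lt_mem_nhds hpa))
      obtain ⟨T', hT', hvT⟩ := frequently_atTop.1 h1 T
      obtain ⟨t, ht, hvt⟩ := frequently_atTop.1 h2 T'
      have := le_of_deriv_neg_at_level hv hvT.le (fun t ht hta => by
        rw [hta]; linarith [hT t (hT'.trans ht)]) t ht
      linarith
    · obtain ⟨T, hT⟩ := eventually_atTop.1 (he.eventually (gt_mem_nhds hpa))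
      obtain ⟨T', hT', hvT⟩ := frequently_atTop.1 h2 T
      obtain ⟨t, ht, hvt⟩ := frequently_atTop.1 h1 T'
      have := le_of_deriv_pos_at_level hv (hab.trans hvT).le (fun t ht hta => by
        rw [hta]; linarith [hT t (hT'.trans ht)]) t ht
      linarith
  refine ⟨m, ?_, hm⟩
  have hlim : Tendsto (fun t => p (v t) - e t) atTop (𝓝 (p m)) := by
    simpa using ((hp.tendsto m).comp hm).sub he
  by_contra hpm
  rcases lt_or_gt_of_ne hpm with hpm | hpm
  · obtain ⟨T, hT⟩ := eventually_atTop.1 (hlim.eventually (gt_mem_nhds (show p m < p m / 2 by linarith)))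
    exact not_tendsto_nhds_of_tendsto_atBot (tendsto_atBot_of_deriv_le (δ := -(p m / 2))
      (by linarith) hv fun t ht => by linarith [hT t ht]) _ hm
  · obtain ⟨T, hT⟩ := eventually_atTop.1 (hlim.eventually (lt_mem_nhds (show p m / 2 < p m by linarith)))
    exact not_tendsto_nhds_of_tendsto_atTop (tendsto_atTop_of_le_deriv (δ := p m / 2)
      (by linarith) hv fun t ht => (hT t ht).le) _ hm

/-! ### Every profile has an asymptotic slope at infinity -/

theorem dense_charPoly_ne_zero (c q : ℝ) : Dense {a : ℝ | a ^ 2 + c * a + q ≠ 0} := by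
  have hfin : {a : ℝ | a ^ 2 + c * a + q = 0}.Finite := by
    refine ((Polynomial.X ^ 2 + Polynomial.C c * Polynomial.X + Polynomial.C q :
      Polynomial ℝ).rootSet_finite ℝ).subset fun a ha => ?_
    rw [Polynomial.mem_rootSet]
    refine ⟨fun h0 => ?_, by simpa using ha⟩
    have := congrArg (fun P => Polynomial.coeff P 2) h0
    simp at this
  exact hfin.countable.dense_compl ℝ

namespace IsUnboundedTW

variable {s c : ℝ} {φ : ℝ → ℝ}

theorem hasDerivAt (h : IsUnboundedTW s c φ) (ξ : ℝ) : HasDerivAt φ (deriv φ ξ) ξ :=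
  (h.contDiff.differentiable (by norm_num) ξ).hasDerivAt

theorem hasDerivAt_deriv (h : IsUnboundedTW s c φ) (ξ : ℝ) :
    HasDerivAt (deriv φ) (-c * deriv φ ξ - φ ξ ^ 3 / (1 + s * φ ξ ^ 2)) ξ := by
  have h2 : ContDiff ℝ 1 (deriv φ) := (contDiff_succ_iff_deriv.1
    (show ContDiff ℝ (1 + 1) φ by simpa [one_add_one_eq_two] using h.contDiff)).2.2
  refine (h2.differentiable (by norm_num) ξ).hasDerivAt.congr_deriv ?_
  linarith [h.eqn ξ]

theorem deriv_neg (h : IsUnboundedTW s c φ) (hs : 0 < s) (ξ : ℝ) : deriv φ ξ < 0 := by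
  have hle : ∀ x, deriv φ x ≤ 0 := fun x => h.decreasing.antitone.deriv_nonpos
  refine (hle ξ).lt_of_ne fun h0 => ?_
  -- a zero of `φ'` is a maximum of `φ'`, where `φ''` vanishes
  have hmax : IsLocalMax (deriv φ) ξ := Eventually.of_forall fun x => by
    rw [h0]; exact hle x
  have := hmax.hasDerivAt_eq_zero (h.hasDerivAt_deriv ξ)
  rw [h0] at this
  have hp := h.pos ξ
  have : 0 < φ ξ ^ 3 / (1 + s * φ ξ ^ 2) := by positivity
  linarith

/-- The logarithmic derivative `w = φ'/φ` satisfies `w' = -(w² + c w + φ²/(1 + s φ²))`; in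
reversed time this is asymptotically autonomous, with limit polynomial `w² + c w + 1/s`. -/
theorem exists_slope (h : IsUnboundedTW s c φ) (hs : 0 < s) (hc : 0 < c) :
    ∃ m, m ^ 2 + c * m + 1 / s = 0 ∧ Tendsto (fun ξ => deriv φ ξ / φ ξ) atBot (𝓝 m) := by
  set v : ℝ → ℝ := fun t => deriv φ (-t) / φ (-t) with hvdef
  have hv : ∀ t, HasDerivAt v ((v t ^ 2 + c * v t + 1 / s) - 1 / (s * (1 + s * φ (-t) ^ 2))) t := by
    intro t
    have hp := h.pos (-t)
    have h1 : HasDerivAt (fun t => φ (-t)) (deriv φ (-t) * -1) t :=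
      (h.hasDerivAt (-t)).comp t (hasDerivAt_neg t)
    have h2 := (h.hasDerivAt_deriv (-t)).comp t (hasDerivAt_neg t)
    refine (h2.div h1 hp.ne').congr_deriv ?_
    have : 0 < 1 + s * φ (-t) ^ 2 := by positivity
    simp only [hvdef, Function.comp]
    field_simp
    ring
  have hneg : ∀ t, v t < 0 := fun t => div_neg_of_neg_of_pos (h.deriv_neg hs _) (h.pos _)
  have he : Tendsto (fun t => 1 / (s * (1 + s * φ (-t) ^ 2))) atTop (𝓝 0) := by
    have h1 : Tendsto (fun t => φ (-t)) atTop atTop := h.lim_neg.comp tendsto_neg_atTop_atBot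
    have h2 : Tendsto (fun t => s * (1 + s * φ (-t) ^ 2)) atTop atTop :=
      (tendsto_atTop_add_const_left _ _
        (((tendsto_pow_atTop two_ne_zero).comp h1).const_mul_atTop hs)).const_mul_atTop hs
    exact h2.const_div_atTop 1
  -- below the level `-c` the quadratic `a² + c a` is nonnegative, so `v` increases there
  have hlo : ∀ t ≥ 0, min (v 0) (-c) ≤ v t := by
    refine le_of_deriv_pos_at_level hv (min_le_left _ _) fun t _ hta => ?_
    have h1 : v t ≤ -c := hta ▸ min_le_right _ _
    have hp := h.pos (-t)
    have h2 : 0 < 1 / s - 1 / (s * (1 + s * φ (-t) ^ 2)) := by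
      have : 1 / s - 1 / (s * (1 + s * φ (-t) ^ 2)) = φ (-t) ^ 2 / (1 + s * φ (-t) ^ 2) := by
        have : 0 < 1 + s * φ (-t) ^ 2 := by positivity
        field_simp
        ring
      rw [this]; positivity
    nlinarith [hneg t]
  obtain ⟨m, hm, hlim⟩ := exists_tendsto_zero_of_asymptotically_autonomous
    (p := fun a => a ^ 2 + c * a + 1 / s) hv he (by fun_prop) (dense_charPoly_ne_zero c (1 / s))
    hlo (fun t _ => (hneg t).le)
  refine ⟨m, hm, ?_⟩
  simpa [hvdef, Function.comp_def] using hlim.comp tendsto_neg_atBot_atTop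

theorem tendsto_deriv_atTop (h : IsUnboundedTW s c φ) (hs : 0 < s) :
    Tendsto (deriv φ) atTop (𝓝 0) := by
  -- `φ' + c φ` is decreasing; were its value negative anywhere, `φ` would tend to `-∞`
  have hy : ∀ ξ, HasDerivAt (fun ξ => deriv φ ξ + c * φ ξ)
      (-(φ ξ ^ 3 / (1 + s * φ ξ ^ 2))) ξ := fun ξ =>
    ((h.hasDerivAt_deriv ξ).add ((h.hasDerivAt ξ).const_mul c)).congr_deriv (by ring)
  have hanti : Antitone (fun ξ => deriv φ ξ + c * φ ξ) :=
    antitone_of_hasDerivAt_nonpos hy fun ξ => by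
      have := h.pos ξ
      exact neg_nonpos.2 (by positivity)
  have hcφ : Tendsto (fun ξ => -(c * φ ξ)) atTop (𝓝 0) := by
    simpa using (h.lim_pos.const_mul c).neg
  have hnn : ∀ ξ, 0 ≤ deriv φ ξ + c * φ ξ := by
    intro ξ
    by_contra! hlt
    set y := deriv φ ξ + c * φ ξ with hydef
    obtain ⟨T, hT⟩ := eventually_atTop.1 ((hcφ.eventually
      (gt_mem_nhds (show (0 : ℝ) < -(y / 2) by linarith))).and (eventually_ge_atTop ξ))
    refine not_tendsto_nhds_of_tendsto_atBot (tendsto_atBot_of_deriv_le (v := φ) (T := T)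
      (δ := -(y / 2)) (by linarith) h.hasDerivAt fun t ht => ?_) _ h.lim_pos
    have h1 := hanti (hT t ht).2
    have h2 := (hT t ht).1
    simp only [] at h1
    linarith
  exact tendsto_of_tendsto_of_tendsto_of_le_of_le hcφ tendsto_const_nhds
    (fun ξ => by simpa [neg_le_iff_add_nonneg] using hnn ξ) (fun ξ => (h.deriv_neg hs ξ).le)

end IsUnboundedTW

/-! ### Exponentially weighted averages -/

section

open BoundedContinuousFunction

theorem integrableOn_exp_mul_mul_Iic {k : ℝ} (hk : 0 < k) (b : ℝ →ᵇ ℝ) (ξ : ℝ) :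
    MeasureTheory.IntegrableOn (fun η => Real.exp (k * η) * b η) (Set.Iic ξ) :=
  (integrableOn_exp_mul_Iic hk ξ).mul_bdd (c := ‖b‖)
    b.continuous.aestronglyMeasurable (Eventually.of_forall b.norm_coe_le_norm)

/-- The solution of `v' = b - k v`, `k > 0`, that is bounded at `-∞`. -/
noncomputable def expAverageFun (k : ℝ) (b : ℝ → ℝ) (ξ : ℝ) : ℝ :=
  Real.exp (-(k * ξ)) * ∫ η in Set.Iic ξ, Real.exp (k * η) * b η

theorem hasDerivAt_expAverageFun {k : ℝ} (hk : 0 < k) (b : ℝ →ᵇ ℝ) (ξ : ℝ) :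
    HasDerivAt (expAverageFun k b) (b ξ - k * expAverageFun k b ξ) ξ := by
  have hI := integrableOn_exp_mul_mul_Iic hk b
  have hcont : Continuous fun η => Real.exp (k * η) * b η := by fun_prop
  have h1 : HasDerivAt (fun ξ => ∫ η in Set.Iic ξ, Real.exp (k * η) * b η)
      (Real.exp (k * ξ) * b ξ) ξ := by
    have h2 : (fun ξ => ∫ η in Set.Iic ξ, Real.exp (k * η) * b η) = fun ξ =>
        (∫ η in Set.Iic (0 : ℝ), Real.exp (k * η) * b η) +
          ∫ η in (0 : ℝ)..ξ, Real.exp (k * η) * b η := by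
      ext x
      rw [← intervalIntegral.integral_Iic_sub_Iic (hI 0) (hI x)]
      ring
    rw [h2]
    exact (intervalIntegral.integral_hasDerivAt_right (hcont.intervalIntegrable _ _)
      (hcont.stronglyMeasurableAtFilter _ _) hcont.continuousAt).const_add _
  have h3 : HasDerivAt (fun ξ => Real.exp (-(k * ξ))) (Real.exp (-(k * ξ)) * -(k * 1)) ξ :=
    (((hasDerivAt_id ξ).const_mul k).neg).exp
  refine (h3.mul h1).congr_deriv ?_
  have : Real.exp (-(k * ξ)) * Real.exp (k * ξ) = 1 := by rw [← Real.exp_add]; simp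
  simp only [expAverageFun]
  linear_combination b ξ * this

theorem abs_expAverageFun_sub_le {k : ℝ} (hk : 0 < k) (b b' : ℝ →ᵇ ℝ) (ξ : ℝ) :
    |expAverageFun k b ξ - expAverageFun k b' ξ| ≤ k⁻¹ * dist b b' := by
  rw [expAverageFun, expAverageFun, ← mul_sub, abs_mul, Real.abs_exp,
    ← MeasureTheory.integral_sub (integrableOn_exp_mul_mul_Iic hk b ξ)
      (integrableOn_exp_mul_mul_Iic hk b' ξ)]
  have h1 : |∫ η in Set.Iic ξ, (Real.exp (k * η) * b η - Real.exp (k * η) * b' η)| ≤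
      ∫ η in Set.Iic ξ, Real.exp (k * η) * dist b b' := by
    rw [← Real.norm_eq_abs]
    refine MeasureTheory.norm_integral_le_of_norm_le
      (g := fun η => Real.exp (k * η) * dist b b')
      ((integrableOn_exp_mul_Iic hk ξ).mul_const _) (Eventually.of_forall fun η => ?_)
    rw [← mul_sub, norm_mul, Real.norm_eq_abs, Real.abs_exp, ← dist_eq_norm]
    gcongr
    exact dist_coe_le_dist η
  rw [MeasureTheory.integral_mul_const, integral_exp_mul_Iic hk] at h1
  calc _ ≤ Real.exp (-(k * ξ)) * (Real.exp (k * ξ) / k * dist b b') := by gcongr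
    _ = (Real.exp (-(k * ξ)) * Real.exp (k * ξ)) * (k⁻¹ * dist b b') := by ring
    _ = k⁻¹ * dist b b' := by rw [← Real.exp_add]; simp

/-- `expAverageFun` as an operator on bounded continuous functions. -/
noncomputable def expAverage {k : ℝ} (hk : 0 < k) (b : ℝ →ᵇ ℝ) : ℝ →ᵇ ℝ :=
  ofNormedAddCommGroup (expAverageFun k b)
    (continuous_iff_continuousAt.2 fun ξ => (hasDerivAt_expAverageFun hk b ξ).continuousAt)
    (k⁻¹ * dist b 0) fun ξ => by
      simpa [expAverageFun] using abs_expAverageFun_sub_le hk b 0 ξ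

theorem hasDerivAt_expAverage {k : ℝ} (hk : 0 < k) (b : ℝ →ᵇ ℝ) (ξ : ℝ) :
    HasDerivAt (expAverage hk b) (b ξ - k * expAverage hk b ξ) ξ :=
  hasDerivAt_expAverageFun hk b ξ

theorem dist_expAverage_le {k : ℝ} (hk : 0 < k) (b b' : ℝ →ᵇ ℝ) :
    dist (expAverage hk b) (expAverage hk b') ≤ k⁻¹ * dist b b' :=
  (dist_le (by positivity)).2 (abs_expAverageFun_sub_le hk b b')

theorem expAverage_nonneg {k : ℝ} (hk : 0 < k) {b : ℝ →ᵇ ℝ} (hb : ∀ ξ, 0 ≤ b ξ) (ξ : ℝ) :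
    0 ≤ expAverage hk b ξ :=
  mul_nonneg (Real.exp_pos _).le
    (MeasureTheory.integral_nonneg fun η => mul_nonneg (Real.exp_pos _).le (hb η))

/-! ### The nonlinearity as a perturbation of its linear part at infinity -/

/-- The deviation `x / s - x³ / (1 + s x²)` of the nonlinearity from its linear part at
infinity. -/
noncomputable def deficit (s x : ℝ) : ℝ := x / (s * (1 + s * x ^ 2))

theorem deficit_eq {s : ℝ} (hs : 0 < s) (x : ℝ) :
    deficit s x = x / s - x ^ 3 / (1 + s * x ^ 2) := by
  have : 0 < 1 + s * x ^ 2 := by positivity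
  rw [deficit]
  field_simp
  ring

theorem continuous_deficit {s : ℝ} (hs : 0 < s) : Continuous (deficit s) := by
  unfold deficit
  exact continuous_id.div (by fun_prop) fun x => by positivity

theorem abs_deficit_sub_le {s : ℝ} (hs : 0 < s) (x y : ℝ) :
    |deficit s x - deficit s y| ≤ s⁻¹ * |x - y| := by
  have hx : 0 < 1 + s * x ^ 2 := by positivity
  have hy : 0 < 1 + s * y ^ 2 := by positivity
  have h1 : deficit s x - deficit s y =
      s⁻¹ * (x - y) * ((1 - s * (x * y)) / ((1 + s * x ^ 2) * (1 + s * y ^ 2))) := by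
    simp only [deficit]
    field_simp
    ring
  have h2 : |(1 - s * (x * y)) / ((1 + s * x ^ 2) * (1 + s * y ^ 2))| ≤ 1 := by
    rw [abs_div, abs_of_pos (mul_pos hx hy), div_le_one (mul_pos hx hy), abs_le]
    have h3 : 0 ≤ s ^ 2 * (x ^ 2 * y ^ 2) := by positivity
    constructor <;> nlinarith [mul_nonneg hs.le (sq_nonneg (x - y)),
      mul_nonneg hs.le (sq_nonneg (x + y)), mul_nonneg hs.le (sq_nonneg x),
      mul_nonneg hs.le (sq_nonneg y)]
  rw [h1, abs_mul, abs_mul, abs_of_pos (inv_pos.2 hs)]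
  exact mul_le_of_le_one_right (by positivity) h2

theorem deficit_le {s : ℝ} (hs : 0 < s) {x : ℝ} (hx : 0 < x) : deficit s x ≤ x⁻¹ / s ^ 2 := by
  have : 0 < 1 + s * x ^ 2 := by positivity
  rw [deficit, inv_eq_one_div, div_div, div_le_div_iff₀ (by positivity) (by positivity)]
  nlinarith

/-! ### Existence of a profile for every asymptotic slope -/

/-- The right-hand side `|deficit|` along `e^{mξ} + e^{-mξ} b(ξ)`, in the weight `e^{-mξ}`. The
absolute value costs nothing in the Lipschitz constant and makes the operator nonnegative. -/
noncomputable def weightedDeficit {s : ℝ} (hs : 0 < s) (m : ℝ) (b : ℝ →ᵇ ℝ) : ℝ →ᵇ ℝ :=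
  ofNormedAddCommGroup
    (fun ξ => Real.exp (m * ξ) * |deficit s (Real.exp (m * ξ) + Real.exp (-(m * ξ)) * b ξ)|)
    (by
      have := continuous_deficit hs
      fun_prop)
    (1 / s ^ 2 + s⁻¹ * ‖b‖) fun ξ => by
      have hE := Real.exp_pos (m * ξ)
      have h1 := abs_deficit_sub_le hs (Real.exp (m * ξ) + Real.exp (-(m * ξ)) * b ξ)
        (Real.exp (m * ξ))
      have h2 : |deficit s (Real.exp (m * ξ))| ≤ (Real.exp (m * ξ))⁻¹ / s ^ 2 := by
        rw [abs_of_nonneg (by unfold deficit; positivity)]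
        exact deficit_le hs hE
      have h3 := abs_sub_abs_le_abs_sub
        (deficit s (Real.exp (m * ξ) + Real.exp (-(m * ξ)) * b ξ)) (deficit s (Real.exp (m * ξ)))
      rw [add_sub_cancel_left, abs_mul, Real.abs_exp, Real.exp_neg] at h1
      rw [Real.norm_eq_abs, abs_mul, Real.abs_exp, abs_abs, Real.exp_neg]
      rw [Real.exp_neg] at h3
      calc _ ≤ Real.exp (m * ξ) * ((Real.exp (m * ξ))⁻¹ / s ^ 2 +
            s⁻¹ * ((Real.exp (m * ξ))⁻¹ * |b ξ|)) := by gcongr; linarith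
        _ = 1 / s ^ 2 + s⁻¹ * |b ξ| := by field_simp
        _ ≤ _ := by gcongr; exact b.norm_coe_le_norm ξ

theorem dist_weightedDeficit_le {s : ℝ} (hs : 0 < s) (m : ℝ) (b b' : ℝ →ᵇ ℝ) :
    dist (weightedDeficit hs m b) (weightedDeficit hs m b') ≤ s⁻¹ * dist b b' := by
  refine (dist_le (by positivity)).2 fun ξ => ?_
  have hE := Real.exp_pos (m * ξ)
  simp only [weightedDeficit, coe_ofNormedAddCommGroup]
  rw [Real.dist_eq, ← mul_sub, abs_mul, Real.abs_exp]
  have h1 := (abs_abs_sub_abs_le _ _).trans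
    (abs_deficit_sub_le hs (Real.exp (m * ξ) + Real.exp (-(m * ξ)) * b ξ)
      (Real.exp (m * ξ) + Real.exp (-(m * ξ)) * b' ξ))
  rw [add_sub_add_left_eq_sub, ← mul_sub, abs_mul, Real.abs_exp] at h1
  calc _ ≤ _ := mul_le_mul_of_nonneg_left h1 hE.le
    _ = s⁻¹ * |b ξ - b' ξ| := by rw [Real.exp_neg]; field_simp
    _ ≤ _ := mul_le_mul_of_nonneg_left (dist_coe_le_dist (f := b) (g := b') ξ) (by positivity)

/-- If `m`, `n` are the roots of `w² + c w + 1/s`, then in the weight `e^{-mξ}` the inverse of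
`(D - m)(D - n)` is a composition of two exponential averages. Its norm `1 / ((-2m)(-m - n))` is
smaller than `s = 1 / (m n)`, so that the deficit is a contracting perturbation. The double root
`m = n` is allowed. -/
theorem exists_fixedPoint_weighted {s m n : ℝ} (hs : 0 < s) (hm : m < 0) (hn : n < 0)
    (hmn : m * n = 1 / s) (h1 : 0 < -m - m) (h2 : 0 < -m - n) :
    ∃ b : ℝ →ᵇ ℝ, expAverage h1 (expAverage h2 (weightedDeficit hs m b)) = b := by
  have hK : 0 ≤ (-m - m)⁻¹ * ((-m - n)⁻¹ * s⁻¹) := by positivity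
  have hlt : (-m - m)⁻¹ * ((-m - n)⁻¹ * s⁻¹) < 1 := by
    rw [← mul_assoc, ← mul_inv, inv_mul_eq_div, div_lt_one (mul_pos h1 h2), inv_eq_one_div, ← hmn]
    nlinarith [mul_pos_of_neg_of_neg hm hn]
  obtain ⟨K, hKeq⟩ : ∃ K : NNReal, (K : ℝ) = (-m - m)⁻¹ * ((-m - n)⁻¹ * s⁻¹) := ⟨⟨_, hK⟩, rfl⟩
  have hc : ContractingWith K
      (fun b : ℝ →ᵇ ℝ => expAverage h1 (expAverage h2 (weightedDeficit hs m b))) := by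
    refine ⟨by exact_mod_cast hKeq ▸ hlt, LipschitzWith.of_dist_le_mul fun b b' => ?_⟩
    calc _ ≤ (-m - m)⁻¹ * ((-m - n)⁻¹ * (s⁻¹ * dist b b')) := by
          refine (dist_expAverage_le h1 _ _).trans ?_
          gcongr
          refine (dist_expAverage_le h2 _ _).trans ?_
          gcongr
          exact dist_weightedDeficit_le hs m b b'
      _ = _ := by rw [hKeq]; ring
  exact ⟨_, hc.fixedPoint_isFixedPt⟩

end

/-- A positive function solving the travelling wave equation whose logarithmic derivative at `-∞` is
`m < 0` decreases: `e^{c ξ} φ'` is decreasing, and it is negative near `-∞`. -/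
theorem deriv_neg_of_slope_neg {s c m : ℝ} {φ ψ : ℝ → ℝ} (hs : 0 < s) (hm : m < 0)
    (hpos : ∀ ξ, 0 < φ ξ)
    (hψ : ∀ ξ, HasDerivAt ψ (-c * ψ ξ - φ ξ ^ 3 / (1 + s * φ ξ ^ 2)) ξ)
    (hslope : Tendsto (fun ξ => ψ ξ / φ ξ) atBot (𝓝 m)) (ξ : ℝ) : ψ ξ < 0 := by
  have hanti : Antitone (fun ξ => Real.exp (c * ξ) * ψ ξ) := by
    refine antitone_of_hasDerivAt_nonpos (f' := fun ξ =>
      -(Real.exp (c * ξ) * (φ ξ ^ 3 / (1 + s * φ ξ ^ 2)))) (fun ξ => ?_) fun ξ => ?_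
    · exact ((((hasDerivAt_id ξ).const_mul c).exp).mul (hψ ξ)).congr_deriv (by simp; ring)
    · have := hpos ξ
      exact neg_nonpos.2 (by positivity)
  obtain ⟨x, hx, hxξ⟩ := ((hslope.eventually (gt_mem_nhds hm)).and (eventually_le_atBot ξ)).exists
  have h1 : ψ x < 0 := by
    by_contra! h
    exact absurd hx (not_lt.2 (div_nonneg h (hpos x).le))
  have h2 : Real.exp (c * ξ) * ψ ξ < 0 :=
    (hanti hxξ).trans_lt (mul_neg_of_pos_of_neg (Real.exp_pos _) h1)
  exact (pos_iff_neg_of_mul_neg h2).1 (Real.exp_pos _)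

/-- A positive decreasing solution tends to `0`: above a level `L > 0` the reaction term would drive
`φ' + c φ`, hence `φ'`, to `-∞`. -/
theorem tendsto_zero_of_deriv_neg {s c : ℝ} {φ ψ : ℝ → ℝ} (hs : 0 < s) (hc : 0 < c)
    (hpos : ∀ ξ, 0 < φ ξ) (hφ : ∀ ξ, HasDerivAt φ (ψ ξ) ξ)
    (hψ : ∀ ξ, HasDerivAt ψ (-c * ψ ξ - φ ξ ^ 3 / (1 + s * φ ξ ^ 2)) ξ)
    (hneg : ∀ ξ, ψ ξ < 0) : Tendsto φ atTop (𝓝 0) := by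
  have hbdd : BddBelow (Set.range φ) := ⟨0, by rintro _ ⟨x, rfl⟩; exact (hpos x).le⟩
  have hanti : Antitone φ := antitone_of_hasDerivAt_nonpos hφ fun ξ => (hneg ξ).le
  have hlim := tendsto_atTop_ciInf hanti hbdd
  set L := ⨅ ξ, φ ξ with hL
  have hLle : ∀ ξ, L ≤ φ ξ := fun ξ => ciInf_le hbdd ξ
  have hL0 : 0 ≤ L := le_ciInf fun ξ => (hpos ξ).le
  rcases hL0.eq_or_lt with h0 | h0
  · rwa [← h0] at hlim
  exfalso
  set δ := L ^ 3 / (1 + s * L ^ 2) with hδ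
  have hδ0 : 0 < δ := by positivity
  have hmono : ∀ ξ, δ ≤ φ ξ ^ 3 / (1 + s * φ ξ ^ 2) := by
    intro ξ
    have hp := hpos ξ
    have hl := hLle ξ
    rw [hδ, div_le_div_iff₀ (by positivity) (by positivity)]
    have h1 : L ^ 3 ≤ φ ξ ^ 3 := by gcongr
    have h2 : 0 ≤ s * (L ^ 2 * φ ξ ^ 2 * (φ ξ - L)) :=
      mul_nonneg hs.le (mul_nonneg (by positivity) (sub_nonneg.2 hl))
    nlinarith
  have hy : Tendsto (fun ξ => ψ ξ + c * φ ξ) atTop atBot :=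
    tendsto_atBot_of_deriv_le (T := 0) hδ0 (fun ξ => (hψ ξ).add ((hφ ξ).const_mul c))
      fun ξ _ => by linarith [hmono ξ]
  have hψbot : Tendsto ψ atTop atBot := tendsto_atBot_mono (fun ξ => by
    nlinarith [hpos ξ]) hy
  obtain ⟨T, hT⟩ := eventually_atTop.1 (hψbot.eventually (eventually_le_atBot (-1)))
  exact not_tendsto_nhds_of_tendsto_atBot (tendsto_atBot_of_deriv_le one_pos hφ hT) _ hlim

/-- For every root `m` of `w² + c w + 1/s` there is an unbounded travelling wave with `φ'/φ → m` at
`-∞`, namely `φ = e^{mξ} + e^{-mξ} b` with `b` the fixed point of `exists_fixedPoint_weighted`. -/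
theorem exists_isUnboundedTW_slope {s c m : ℝ} (hs : 0 < s) (hc : 0 < c)
    (hm : m ^ 2 + c * m + 1 / s = 0) :
    ∃ φ, IsUnboundedTW s c φ ∧ Tendsto (fun ξ => deriv φ ξ / φ ξ) atBot (𝓝 m) := by
  have hs' : 0 < 1 / s := by positivity
  have hm0 : m < 0 := by nlinarith [sq_nonneg m]
  obtain ⟨n, hn⟩ : ∃ n, n = -c - m := ⟨_, rfl⟩
  have hmn : m * n = 1 / s := by rw [hn]; linear_combination -hm
  have hn0 : n < 0 := by
    by_contra! h
    nlinarith [mul_nonneg (neg_nonneg.2 hm0.le) h]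
  have h1 : 0 < -m - m := by linarith
  have h2 : 0 < -m - n := by linarith
  obtain ⟨b, hb⟩ := exists_fixedPoint_weighted hs hm0 hn0 hmn h1 h2
  set N := weightedDeficit hs m b with hN
  set v := expAverage h2 N with hv
  have hNnn : ∀ ξ, 0 ≤ N ξ := fun ξ => mul_nonneg (Real.exp_pos _).le (abs_nonneg _)
  have hbnn : ∀ ξ, 0 ≤ b ξ := fun ξ => by
    rw [← hb]; exact expAverage_nonneg h1 (expAverage_nonneg h2 hNnn) ξ
  have hv' : ∀ ξ, HasDerivAt v (N ξ - (-m - n) * v ξ) ξ := hasDerivAt_expAverage h2 N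
  have hb' : ∀ ξ, HasDerivAt b (v ξ - (-m - m) * b ξ) ξ := fun ξ => by
    have := hasDerivAt_expAverage h1 v ξ
    rwa [hb] at this
  set E : ℝ → ℝ := fun ξ => Real.exp (m * ξ) with hE
  set F : ℝ → ℝ := fun ξ => Real.exp (-(m * ξ)) with hF
  have hE' : ∀ ξ, HasDerivAt E (m * E ξ) ξ := fun ξ =>
    (((hasDerivAt_id ξ).const_mul m).exp).congr_deriv (by simp [hE]; ring)
  have hF' : ∀ ξ, HasDerivAt F (-m * F ξ) ξ := fun ξ =>
    (((hasDerivAt_id ξ).const_mul m).neg.exp).congr_deriv (by simp [hF]; ring)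
  have hEpos : ∀ ξ, 0 < E ξ := fun ξ => Real.exp_pos _
  have hFpos : ∀ ξ, 0 < F ξ := fun ξ => Real.exp_pos _
  have hFE : ∀ ξ, F ξ * E ξ = 1 := fun ξ => by
    simp only [hE, hF]; rw [← Real.exp_add]; simp
  set φ : ℝ → ℝ := fun ξ => E ξ + F ξ * b ξ with hφdef
  set ψ : ℝ → ℝ := fun ξ => m * E ξ + F ξ * (v ξ + m * b ξ) with hψdef
  have hEφ : ∀ ξ, E ξ ≤ φ ξ := fun ξ =>
    le_add_of_nonneg_right (mul_nonneg (hFpos ξ).le (hbnn ξ))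
  have hpos : ∀ ξ, 0 < φ ξ := fun ξ => (hEpos ξ).trans_le (hEφ ξ)
  have hφ : ∀ ξ, HasDerivAt φ (ψ ξ) ξ := fun ξ =>
    ((hE' ξ).add ((hF' ξ).mul (hb' ξ))).congr_deriv (by simp only [hψdef]; ring)
  have hFN : ∀ ξ, F ξ * N ξ = φ ξ / s - φ ξ ^ 3 / (1 + s * φ ξ ^ 2) := by
    intro ξ
    have hp := hpos ξ
    have hNξ : N ξ = E ξ * |deficit s (φ ξ)| := rfl
    rw [hNξ, ← mul_assoc, hFE, one_mul, ← deficit_eq hs, abs_of_nonneg]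
    unfold deficit
    positivity
  have hψ : ∀ ξ, HasDerivAt ψ (-c * ψ ξ - φ ξ ^ 3 / (1 + s * φ ξ ^ 2)) ξ := by
    intro ξ
    refine (((hE' ξ).const_mul m).add ((hF' ξ).mul ((hv' ξ).add
      ((hb' ξ).const_mul m)))).congr_deriv ?_
    simp only [Pi.add_apply, hψdef]
    have h3 := hFN ξ
    rw [div_eq_mul_one_div (φ ξ) s, ← hmn] at h3
    have h4 : φ ξ ^ 3 / (1 + s * φ ξ ^ 2) = φ ξ * (m * n) - F ξ * N ξ := by linarith
    rw [h4, show c = -m - n by linarith]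
    simp only [hφdef]
    ring
  have hd : deriv φ = ψ := funext fun ξ => (hφ ξ).deriv
  have hslope : Tendsto (fun ξ => ψ ξ / φ ξ) atBot (𝓝 m) := by
    have hFlim : Tendsto (fun ξ => F ξ ^ 2) atBot (𝓝 0) := by
      have h3 : Tendsto F atBot (𝓝 0) := by
        refine Real.tendsto_exp_atBot.comp ?_
        have : Tendsto (fun ξ : ℝ => (-m) * ξ) atBot atBot :=
          tendsto_id.const_mul_atBot (neg_pos.2 hm0)
        simpa using this
      simpa using h3.pow 2
    have hbd : ∀ (g : BoundedContinuousFunction ℝ ℝ), Tendsto (fun ξ => F ξ ^ 2 * g ξ) atBot (𝓝 0) :=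
      fun g => hFlim.zero_mul_isBoundedUnder_le
        ⟨‖g‖, eventually_map.2 (Eventually.of_forall g.norm_coe_le_norm)⟩
    have hnum : Tendsto (fun ξ => m + (F ξ ^ 2 * v ξ + m * (F ξ ^ 2 * b ξ))) atBot (𝓝 m) := by
      simpa using ((hbd v).add ((hbd b).const_mul m)).const_add m
    have hden : Tendsto (fun ξ => 1 + F ξ ^ 2 * b ξ) atBot (𝓝 1) := by
      simpa using (hbd b).const_add 1
    have := hnum.div hden one_ne_zero
    rw [div_one] at this
    refine this.congr fun ξ => ?_
    have hden0 : 0 < 1 + F ξ ^ 2 * b ξ := by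
      have := mul_nonneg (sq_nonneg (F ξ)) (hbnn ξ)
      linarith
    simp only [Pi.div_apply]
    rw [div_eq_div_iff hden0.ne' (hpos ξ).ne']
    simp only [hφdef, hψdef]
    linear_combination (F ξ * v ξ) * hFE ξ
  have hneg := deriv_neg_of_slope_neg hs hm0 hpos hψ hslope
  refine ⟨φ, ⟨?_, ?_, hpos, ?_, ?_, tendsto_zero_of_deriv_neg hs hc hpos hφ hψ hneg⟩, by
    rwa [hd]⟩
  · rw [show (2 : WithTop ℕ∞) = 1 + 1 by norm_num, contDiff_succ_iff_deriv]
    refine ⟨fun ξ => (hφ ξ).differentiableAt, by simp, ?_⟩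
    have hψc : Continuous ψ := continuous_iff_continuousAt.2 fun ξ => (hψ ξ).continuousAt
    have hφc : Continuous φ := continuous_iff_continuousAt.2 fun ξ => (hφ ξ).continuousAt
    rw [hd, contDiff_one_iff_deriv]
    refine ⟨fun ξ => (hψ ξ).differentiableAt, ?_⟩
    rw [show deriv ψ = _ from funext fun ξ => (hψ ξ).deriv]
    refine (hψc.const_mul _).sub ((hφc.pow 3).div (by fun_prop) fun ξ => ?_)
    positivity
  · intro ξ
    rw [hd, (hψ ξ).deriv]
    ring
  · exact strictAnti_of_deriv_neg fun ξ => by rw [hd]; exact hneg ξ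
  · refine tendsto_atTop_mono hEφ (Real.tendsto_exp_atTop.comp ?_)
    exact tendsto_id.const_mul_atBot_of_neg hm0

/-! ### Slopes and equilibria at infinity -/

/-- The point at infinity in the direction `(1, m)`. -/
noncomputable def slopePoint (m : ℝ) : ℝ × ℝ × ℝ := (1 / √(1 + m ^ 2), m / √(1 + m ^ 2), 0)

theorem slopePoint_injective : Function.Injective slopePoint := by
  intro m n h
  have hm : 0 < √(1 + m ^ 2) := by positivity
  have hn : 0 < √(1 + n ^ 2) := by positivity
  simp only [slopePoint, Prod.mk.injEq] at h
  have h1 : √(1 + m ^ 2) = √(1 + n ^ 2) := by simpa using h.1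
  have h2 := h.2.1
  rw [h1] at h2
  exact (div_left_inj' hn.ne').1 h2

theorem isEquilibriumAtInfinity_slopePoint {s c m : ℝ} (hs : 0 < s)
    (hm : m ^ 2 + c * m + 1 / s = 0) : IsEquilibriumAtInfinity s c (slopePoint m) := by
  have hpos : 0 < √(1 + m ^ 2) := by positivity
  have hsq : √(1 + m ^ 2) ^ 2 = 1 + m ^ 2 := Real.sq_sqrt (by positivity)
  have hm' : s * m ^ 2 + c * s * m + 1 = 0 := by
    field_simp at hm
    linear_combination hm
  set R := √(1 + m ^ 2)
  refine ⟨?_, rfl, ?_⟩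
  · simp only [slopePoint]
    field_simp
    linear_combination -hsq
  · simp only [slopePoint, compactField, homP, homQ, Prod.mk_eq_zero]
    refine ⟨?_, ?_, by simp⟩
    · field_simp
      rw [hsq]
      linear_combination m * hm'
    · field_simp
      rw [hsq]
      linear_combination -hm'

theorem toHemisphere_eq {φ ψ : ℝ} (hφ : 0 < φ) : toHemisphere φ ψ =
    (1 / √(1 + (ψ / φ) ^ 2 + φ⁻¹ ^ 2), (ψ / φ) / √(1 + (ψ / φ) ^ 2 + φ⁻¹ ^ 2),
      φ⁻¹ / √(1 + (ψ / φ) ^ 2 + φ⁻¹ ^ 2)) := by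
  have h : bigDelta φ ψ = φ * √(1 + (ψ / φ) ^ 2 + φ⁻¹ ^ 2) := by
    rw [bigDelta, Real.sqrt_eq_iff_mul_self_eq (by positivity) (by positivity),
      mul_mul_mul_comm, Real.mul_self_sqrt (by positivity)]
    field_simp
  have hR : 0 < √(1 + (ψ / φ) ^ 2 + φ⁻¹ ^ 2) := by positivity
  simp only [toHemisphere, h, Prod.mk.injEq]
  refine ⟨?_, ?_, ?_⟩ <;> field_simp

namespace IsUnboundedTW

variable {s c m : ℝ} {φ : ℝ → ℝ}

theorem tendsto_slopePoint (h : IsUnboundedTW s c φ)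
    (hm : Tendsto (fun ξ => deriv φ ξ / φ ξ) atBot (𝓝 m)) :
    Tendsto (fun ξ => toHemisphere (φ ξ) (deriv φ ξ)) atBot (𝓝 (slopePoint m)) := by
  simp only [fun ξ => toHemisphere_eq (ψ := deriv φ ξ) (h.pos ξ)]
  have hinv : Tendsto (fun ξ => (φ ξ)⁻¹) atBot (𝓝 0) := h.lim_neg.inv_tendsto_atTop
  have hR : Tendsto (fun ξ => √(1 + (deriv φ ξ / φ ξ) ^ 2 + (φ ξ)⁻¹ ^ 2)) atBot
      (𝓝 (√(1 + m ^ 2))) := by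
    simpa using (((hm.pow 2).const_add 1).add (hinv.pow 2)).sqrt
  have hR0 : √(1 + m ^ 2) ≠ 0 := by positivity
  have h3 := hinv.div hR hR0
  rw [zero_div] at h3
  exact (tendsto_const_nhds.div hR hR0).prodMk_nhds ((hm.div hR hR0).prodMk_nhds h3)

theorem hasType_slopePoint (h : IsUnboundedTW s c φ) (hs : 0 < s)
    (hroot : m ^ 2 + c * m + 1 / s = 0)
    (hm : Tendsto (fun ξ => deriv φ ξ / φ ξ) atBot (𝓝 m)) : HasType s c φ (slopePoint m) := by
  refine ⟨h, isEquilibriumAtInfinity_slopePoint hs hroot, h.tendsto_slopePoint hm, ?_⟩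
  have hcont : Continuous fun p : ℝ × ℝ => toHemisphere p.1 p.2 := by
    have hΔ : Continuous fun p : ℝ × ℝ => bigDelta p.1 p.2 := by unfold bigDelta; fun_prop
    have h0 : ∀ p : ℝ × ℝ, bigDelta p.1 p.2 ≠ 0 := fun p => by unfold bigDelta; positivity
    exact (continuous_fst.div hΔ h0).prodMk
      ((continuous_snd.div hΔ h0).prodMk (continuous_const.div hΔ h0))
  exact (hcont.tendsto (0, 0)).comp (h.lim_pos.prodMk_nhds (h.tendsto_deriv_atTop hs))

end IsUnboundedTW

theorem setOf_hasType {s c : ℝ} (hs : 0 < s) (hc : 0 < c) :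
    {e | ∃ φ, HasType s c φ e} = slopePoint '' {m | m ^ 2 + c * m + 1 / s = 0} := by
  ext e
  constructor
  · rintro ⟨φ, h⟩
    obtain ⟨m, hroot, hm⟩ := h.1.exists_slope hs hc
    exact ⟨m, hroot, tendsto_nhds_unique (h.1.tendsto_slopePoint hm) h.2.2.1⟩
  · rintro ⟨m, hroot, rfl⟩
    obtain ⟨φ, h, hm⟩ := exists_isUnboundedTW_slope hs hc hroot
    exact ⟨φ, h.hasType_slopePoint hs hroot hm⟩

theorem exactlyTypes_of_encard {s c : ℝ} {n : ℕ} (hs : 0 < s) (hc : 0 < c)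
    (hn : {m : ℝ | m ^ 2 + c * m + 1 / s = 0}.encard = n) : ExactlyTypes s c n := by
  refine ⟨fun φ h => ?_, ?_⟩
  · obtain ⟨m, hroot, hm⟩ := h.exists_slope hs hc
    exact ⟨_, h.hasType_slopePoint hs hroot hm⟩
  · rw [setOf_hasType hs hc, slopePoint_injective.encard_image, hn]

theorem theorem1 (s : ℝ) (hs : 0 < s) :
    ∃ cStar : ℝ, 0 < cStar ∧ cStar = 2 / √s ∧
      (∀ c : ℝ, 0 < c → c < cStar → ¬ ∃ φ : ℝ → ℝ, IsUnboundedTW s c φ) ∧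
      (∀ c : ℝ, c = cStar → ExactlyTypes s c 1) ∧
      (∀ c : ℝ, cStar < c → ExactlyTypes s c 2) := by
  have hpos : 0 < 2 / √s := by positivity
  have hsq : (2 / √s) ^ 2 = 4 * (1 / s) := by
    rw [div_pow, Real.sq_sqrt hs.le]
    ring
  refine ⟨2 / √s, hpos, rfl, ?_, ?_, ?_⟩
  · rintro c hc hlt ⟨φ, h⟩
    obtain ⟨m, hroot, -⟩ := h.exists_slope hs hc
    have : c ^ 2 < (2 / √s) ^ 2 := by gcongr
    nlinarith [sq_nonneg (2 * m + c)]
  · rintro c rfl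
    refine exactlyTypes_of_encard hs hpos ?_
    rw [Nat.cast_one, Set.encard_eq_one]
    refine ⟨-(2 / √s) / 2, Set.ext fun m => ?_⟩
    rw [Set.mem_ofPred_eq, Set.mem_singleton_iff,
      show m ^ 2 + 2 / √s * m + 1 / s = (m - -(2 / √s) / 2) ^ 2 by linear_combination (-1 / 4) * hsq,
      sq_eq_zero_iff, sub_eq_zero]
  · intro c hlt
    have hc := hpos.trans hlt
    refine exactlyTypes_of_encard hs hc ?_
    have hD : 0 < c ^ 2 - 4 * (1 / s) := by
      rw [← hsq, sub_pos]
      gcongr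
    obtain ⟨d, hd, hd2⟩ : ∃ d : ℝ, 0 < d ∧ d ^ 2 = c ^ 2 - 4 * (1 / s) :=
      ⟨√(c ^ 2 - 4 * (1 / s)), Real.sqrt_pos.2 hD, Real.sq_sqrt hD.le⟩
    rw [Nat.cast_ofNat, Set.encard_eq_two]
    refine ⟨(-c - d) / 2, (-c + d) / 2, by intro h; linarith, Set.ext fun m => ?_⟩
    rw [Set.mem_ofPred_eq, Set.mem_insert_iff, Set.mem_singleton_iff,
      show m ^ 2 + c * m + 1 / s = (m - (-c - d) / 2) * (m - (-c + d) / 2) by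
        linear_combination (1 / 4) * hd2, mul_eq_zero, sub_eq_zero, sub_eq_zero]
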